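/- **Conventions.** A profinite completion of a topological group $S$ is a pair $(\operatorname{Prof}(S),\alpha_S)$ consisting of a profinite group (compact, Hausdorff, totally disconnected) and a continuous homomorphism $\alpha_S:S\to\operatorname{Prof}(S)$ with dense image such that every continuous homomorphism from $S$ to a profinite group $L$ factors through $\alpha_S$ by a continuous homomorphism $\operatorname{Prof}(S)\to L$. For a continuous unitary representation $\sigma:S\to U(n)$ with finite image, $\operatorname{Prof}(\sigma):\operatorname{Prof}(S)\to U(n)$ denotes the continuous homomorphism with $\operatorname{Prof}(\sigma)\circ\alpha_S=\sigma$. For topological groups, $\cong$ means topologically isomorphic. **Theorem.** Let $G=N\rtimes H$ be a locally compact (Hausdorff) group which is the topological semidirect product of a closed normal subgroup $N$ and a closed subgroup $H$ (i.e. multiplication $N\times H\to G$ is a homeomorphism). Let $(\operatorname{Prof}(G),\alpha_G)$, $(\operatorname{Prof}(N),\alpha_N)$, $(\operatorname{Prof}(H),\alpha_H)$ be profinite completions of $G$, $N$, $H$. Let $\psi_N:\operatorname{Prof}(N)\to\overline{\alpha_G(N)}$ and $\psi_H:\operatorname{Prof}(H)\to\overline{\alpha_G(H)}$ be the continuous homomorphisms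 with $\psi_N\circ\alpha_N=\alpha_G|_N$ and $\psi_H\circ\alpha_H=\alpha_G|_H$. Let $\widehat N_{\rm finite}^{H-{\rm per}}$ be the set of equivalence classes (modulo unitary equivalence) of irreducible finite-dimensional unitary representations $\sigma$ of $N$ with finite image whose orbit under the action $\sigma^h(n)=\sigma(h^{-1}nh)$ of $H$ on equivalence classes is finite, and set $$D:=\bigcap_{\sigma\in\widehat N_{\rm finite}^{H-{\rm per}}}\operatorname{Ker}(\operatorname{Prof}(\sigma))\subset\operatorname{Prof}(N).$$ (i) $\operatorname{Ker}\psi_N=D$, and $\psi_N$ induces a topological isomorphism $\overline{\psi_N}:\operatorname{Prof}(N)/D\to\overline{\alpha_G(N)}$. (ii) $\psi_H:\operatorname{Prof}(H)\to\overline{\alpha_G(H)}$ is a topological isomorphism. (iii) Let $H$ act on $\operatorname{Prof}(N)$ by the continuous automorphisms $\theta(h)$ with $\theta(h)(\alpha_N(n))=\alpha_N(hnh^{-1})$ for $n\in N$. Then $D$ is $H$-invariant, and the action of $H$ on $\operatorname{Prof}(N)/D$ induces a continuous action $\widehat\theta$ of $\operatorname{Prof}(H)$ on $\operatorname{Prof}(N)/D$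 by automorphisms, with $\widehat\theta(\alpha_H(h))(xD)=\theta(h)(x)D$ for all $h\in H$, $x\in\operatorname{Prof}(N)$. For this action, the map $$(\operatorname{Prof}(N)/D)\rtimes\operatorname{Prof}(H)\to\operatorname{Prof}(G),\qquad (xD,y)\mapsto\psi_N(x)\psi_H(y)$$ is an isomorphism of topological groups; in particular $\operatorname{Prof}(G)\cong(\operatorname{Prof}(N)/D)\rtimes\operatorname{Prof}(H)$. -/

import Mathlib

universe u v

/-- A profinite group: a compact, Hausdorff, totally disconnected topological group. -/
class IsProfiniteGroup (K : Type u) [Group K] [TopologicalSpace K] : Prop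
    extends IsTopologicalGroup K, CompactSpace K, T2Space K, TotallyDisconnectedSpace K

/-- `(K, α)` is a profinite completion of the topological group `G`: `K` is a profinite group,
`α : G → K` is a continuous homomorphism with dense image, and every continuous homomorphism
from `G` to a profinite group factors through `α` by a continuous homomorphism. -/
structure IsProfiniteCompletion {G K : Type u} [Group G] [TopologicalSpace G]
    [Group K] [TopologicalSpace K] (α : G →ₜ* K) : Prop where
  profinite : IsProfiniteGroup K
  denseRange : DenseRange α
  exists_lift : ∀ (L : Type u) [Group L] [TopologicalSpace L] [IsProfiniteGroup L]
    (f : G →ₜ* L), ∃ f' : K →ₜ* L, ∀ g, f' (α g) = f g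

section ProfiniteCompletion

variable {G K L : Type u} [Group G] [TopologicalSpace G] [Group K] [TopologicalSpace K]
  [Group L] [TopologicalSpace L]

/-- Continuous homomorphisms out of a profinite completion are determined on `G`. -/
theorem IsProfiniteCompletion.hom_ext {α : G →ₜ* K} (hα : IsProfiniteCompletion α)
    {M : Type v} [Group M] [TopologicalSpace M] [T2Space M] {f f' : K →ₜ* M}
    (h : ∀ g, f (α g) = f' (α g)) : f = f' :=
  DFunLike.coe_injective
    (hα.denseRange.equalizer (map_continuous f) (map_continuous f') (funext h))

/-- The continuous homomorphism `K → L` induced by `f : G → L`, for a profinite group `L`. -/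
noncomputable def IsProfiniteCompletion.lift {α : G →ₜ* K} (hα : IsProfiniteCompletion α)
    [IsProfiniteGroup L] (f : G →ₜ* L) : K →ₜ* L :=
  (hα.exists_lift L f).choose

theorem IsProfiniteCompletion.lift_apply {α : G →ₜ* K} (hα : IsProfiniteCompletion α)
    [IsProfiniteGroup L] (f : G →ₜ* L) (g : G) : hα.lift f (α g) = f g :=
  (hα.exists_lift L f).choose_spec g

/-- Every topological group has a profinite completion: the closure of the image of `G` in the
product of the quotients of `G` by its open normal subgroups of finite index. -/
theorem exists_isProfiniteCompletion (G : Type u) [Group G] [TopologicalSpace G]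
    [IsTopologicalGroup G] :
    ∃ (K : Type u) (_ : Group K) (_ : TopologicalSpace K) (α : G →ₜ* K),
      IsProfiniteCompletion α := by
  let I := {U : Subgroup G // U.Normal ∧ IsOpen (U : Set G) ∧ U.FiniteIndex}
  have hn (i : I) : i.1.Normal := i.2.1
  have hd (i : I) : DiscreteTopology (G ⧸ i.1) := QuotientGroup.discreteTopology i.2.2.1
  have hf (i : I) : Finite (G ⧸ i.1) := have := i.2.2.2; inferInstance
  let d : G →ₜ* (∀ i : I, G ⧸ i.1) :=
    { toFun := fun g i => (g : G ⧸ i.1)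
      map_one' := rfl
      map_mul' := fun _ _ => rfl
      continuous_toFun := continuous_pi fun i => continuous_quotient_mk' }
  let K : Subgroup (∀ i : I, G ⧸ i.1) := d.toMonoidHom.range.topologicalClosure
  have hK : CompactSpace K :=
    isCompact_iff_compactSpace.mp (Subgroup.isClosed_topologicalClosure _).isCompact
  let α : G →ₜ* K :=
    { toFun := fun g => ⟨d g, Subgroup.le_topologicalClosure _ ⟨g, rfl⟩⟩
      map_one' := rfl
      map_mul' := fun _ _ => rfl
      continuous_toFun := (map_continuous d).subtype_mk _ }
  have hα : DenseRange α := by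
    rw [DenseRange, Subtype.dense_iff]
    intro x hx
    have : Subtype.val '' Set.range α = (d.toMonoidHom.range : Set (∀ i : I, G ⧸ i.1)) := by
      rw [← Set.range_comp]; rfl
    exact (congrArg closure this).symm ▸ hx
  refine ⟨K, inferInstance, inferInstance, α, { }, hα, fun L _ _ _ f => ?_⟩
  let R : Subgroup (K × L) := (α.prod f).toMonoidHom.range.topologicalClosure
  have hRc : IsClosed (R : Set (K × L)) := Subgroup.isClosed_topologicalClosure _
  have hR : CompactSpace R := isCompact_iff_compactSpace.mp hRc.isCompact
  have hmem (g : G) : (α g, f g) ∈ R := Subgroup.le_topologicalClosure _ ⟨g, rfl⟩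
  let p : R →* K := (MonoidHom.fst K L).comp R.subtype
  have hp : Continuous p := continuous_fst.comp continuous_subtype_val
  have hpinj : Function.Injective p := by
    rw [injective_iff_map_eq_one]
    rintro ⟨⟨k, z⟩, hz⟩ (hk : k = 1)
    subst hk
    have hz1 : z = 1 := by
      by_contra hne
      obtain ⟨V, hV⟩ := ProfiniteGrp.exist_openNormalSubgroup_sub_open_nhds_of_one
        (G := L) (isOpen_compl_singleton (x := z)) (by simpa using Ne.symm hne)
      have hVf : V.toSubgroup.FiniteIndex := Subgroup.finiteIndex_of_finite_quotient
      have hfin : (V.toSubgroup.comap f.toMonoidHom).FiniteIndex := by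
        refine ⟨?_⟩
        rw [Subgroup.index_comap]
        exact Subgroup.FiniteIndex.index_ne_zero (H := V.toSubgroup.subgroupOf f.toMonoidHom.range)
      let i : I := ⟨V.toSubgroup.comap f.toMonoidHom, inferInstance,
        V.isOpen'.preimage (map_continuous f), hfin⟩
      let C : Set (K × L) := {q | q.1.1 i = 1 → q.2 ∈ (V : Set L)}
      have hC : IsClosed C := by
        have h1 : IsOpen {q : K × L | q.1.1 i = 1} :=
          (isOpen_discrete ({1} : Set (G ⧸ i.1))).preimage (f := fun q : K × L => q.1.1 i)
            ((continuous_apply (A := fun i : I => G ⧸ i.1) i).comp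
              (continuous_subtype_val.comp continuous_fst))
        have h2 : IsClosed {q : K × L | q.2 ∈ (V : Set L)} :=
          (V.toOpenSubgroup.isClosed).preimage continuous_snd
        exact isClosed_imp h1 h2
      have hsub : (R : Set (K × L)) ⊆ C := by
        refine closure_minimal ?_ hC
        rintro _ ⟨g, rfl⟩ (hg : ((g : G) : G ⧸ i.1) = 1)
        exact (QuotientGroup.eq_one_iff g).mp hg
      exact hV (hsub hz rfl) rfl
    subst hz1
    rfl
  have hpsurj : Function.Surjective p := by
    rw [← Set.range_eq_univ, ← (isCompact_range hp).isClosed.closure_eq]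
    exact (hα.mono (by rintro _ ⟨g, rfl⟩; exact ⟨⟨_, hmem g⟩, rfl⟩)).closure_eq
  let e : R ≃* K := MulEquiv.ofBijective p ⟨hpinj, hpsurj⟩
  let h : R ≃ₜ K := hp.homeoOfEquivCompactToT2 (f := e.toEquiv)
  have hsymm : Continuous e.symm := h.continuous_symm
  refine ⟨{ toMonoidHom := ((MonoidHom.snd K L).comp R.subtype).comp e.symm.toMonoidHom
            continuous_toFun := continuous_snd.comp (continuous_subtype_val.comp hsymm) },
    fun g => ?_⟩
  change (e.symm (α g)).1.2 = f g
  have : e.symm (α g) = ⟨_, hmem g⟩ := by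
    rw [MulEquiv.symm_apply_eq]; rfl
  rw [this]

end ProfiniteCompletion

/-! ### Finite-dimensional unitary representations -/

/-- Unitary representations of `N` on `ℂⁿ`: continuous homomorphisms `N → U(n)`. -/
abbrev UnitaryRep (N : Type u) [Group N] [TopologicalSpace N] (n : ℕ) :=
  N →ₜ* Matrix.unitaryGroup (Fin n) ℂ

namespace UnitaryRep

variable {N : Type u} [Group N] [TopologicalSpace N] {n : ℕ}

/-- The linear representation on `ℂⁿ` underlying a unitary representation. -/
noncomputable def toRepresentation (σ : UnitaryRep N n) : Representation ℂ N (Fin n → ℂ) :=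
  ((Matrix.toLinAlgEquiv' : Matrix (Fin n) (Fin n) ℂ ≃ₐ[ℂ] _) : _ →* _).comp
    ((Matrix.unitaryGroup (Fin n) ℂ).subtype.comp σ.toMonoidHom)

/-- Unitary equivalence of representations. -/
def setoid (N : Type u) [Group N] [TopologicalSpace N] (n : ℕ) : Setoid (UnitaryRep N n) where
  r σ τ := ∃ U : Matrix.unitaryGroup (Fin n) ℂ, ∀ x, U * σ x * U⁻¹ = τ x
  iseqv :=
    { refl := fun σ => ⟨1, fun x => by simp⟩
      symm := by
        rintro σ τ ⟨U, hU⟩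
        exact ⟨U⁻¹, fun x => by rw [← hU]; group⟩
      trans := by
        rintro σ τ ρ ⟨U, hU⟩ ⟨V, hV⟩
        exact ⟨V * U, fun x => by rw [← hV, ← hU]; group⟩ }

/-- If `σ` is a unitary representation of `N` with finite image and `(P, α)` is a profinite
completion of `N`, then `σ` extends to a continuous homomorphism `P → U(n)`. -/
theorem exists_extension {P : Type u} [Group P] [TopologicalSpace P] {α : N →ₜ* P}
    (hα : IsProfiniteCompletion α) (σ : UnitaryRep N n) (hσ : (Set.range σ).Finite) :
    ∃ σ' : UnitaryRep P n, ∀ x, σ' (α x) = σ x := by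
  let R : Subgroup (Matrix.unitaryGroup (Fin n) ℂ) := σ.toMonoidHom.range
  have hR : Finite R := hσ.to_subtype
  have : IsTopologicalGroup R := inferInstance
  have : IsTopologicalGroup (ULift.{u} R) := inferInstance
  have : Finite (ULift.{u} R) := inferInstance
  have : DiscreteTopology (ULift.{u} R) := inferInstance
  have : IsProfiniteGroup (ULift.{u} R) := { }
  let f : N →ₜ* ULift.{u} R :=
    { toFun := fun x => ⟨⟨σ x, x, rfl⟩⟩
      map_one' := by ext1; ext1; exact map_one σ
      map_mul' := fun x y => by ext1; ext1; exact map_mul σ x y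
      continuous_toFun := continuous_uliftUp.comp ((map_continuous σ).subtype_mk _) }
  let down : ULift.{u} R →ₜ* Matrix.unitaryGroup (Fin n) ℂ :=
    { toFun := fun x => x.down
      map_one' := rfl
      map_mul' := fun _ _ => rfl
      continuous_toFun := continuous_subtype_val.comp continuous_uliftDown }
  refine ⟨down.comp (hα.lift f), fun x => ?_⟩
  change down (hα.lift f (α x)) = σ x
  rw [hα.lift_apply]
  rfl

/-- `Prof(σ)`, the unitary representation of the profinite completion of `N` that extends the
unitary representation `σ` with finite image; it is characterized by `Prof(σ) ∘ α = σ`. -/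
noncomputable def prof {P : Type u} [Group P] [TopologicalSpace P] {α : N →ₜ* P}
    (hα : IsProfiniteCompletion α) (σ : UnitaryRep N n) (hσ : (Set.range σ).Finite) :
    UnitaryRep P n :=
  (exists_extension hα σ hσ).choose

theorem prof_apply {P : Type u} [Group P] [TopologicalSpace P] {α : N →ₜ* P}
    (hα : IsProfiniteCompletion α) (σ : UnitaryRep N n) (hσ : (Set.range σ).Finite) (x : N) :
    prof hα σ hσ (α x) = σ x :=
  (exists_extension hα σ hσ).choose_spec x

end UnitaryRep

/-! ### Semidirect products -/

/-- The product topology on a semidirect product. -/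
instance SemidirectProduct.instTopologicalSpaceProd {N : Type u} {H : Type v} [Group N] [Group H]
    [TopologicalSpace N] [TopologicalSpace H] (φ : H →* MulAut N) :
    TopologicalSpace (N ⋊[φ] H) :=
  TopologicalSpace.induced (fun a => (a.left, a.right)) inferInstance

section Extension

variable {G : Type u} [Group G] [TopologicalSpace G]

/-- The topological group `G` is the (topological) semidirect product of its closed normal subgroup
`N` and its closed subgroup `H`: multiplication `N × H → G` is a homeomorphism. -/
structure IsTopologicalSemidirectProduct (N H : Subgroup G) : Prop where
  normal : N.Normal
  isClosed_left : IsClosed (N : Set G)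
  isClosed_right : IsClosed (H : Set G)
  isHomeomorph : IsHomeomorph (fun p : N × H => (p.1 : G) * (p.2 : G))

variable [IsTopologicalGroup G]

/-- Conjugation `x ↦ g x g⁻¹` on a normal subgroup. -/
def conjHom (N : Subgroup G) [N.Normal] (g : G) : N →ₜ* N where
  toMonoidHom := (MulAut.conjNormal g : N ≃* N).toMonoidHom
  continuous_toFun := by
    refine Continuous.subtype_mk (f := fun x : N => g * x * g⁻¹) ?_ _
    fun_prop

theorem conjHom_apply (N : Subgroup G) [N.Normal] (g : G) (x : N) :
    (conjHom N g x : G) = g * x * g⁻¹ := rfl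

/-- The conjugate representation `σ^g`, given by `σ^g(x) = σ(g⁻¹ x g)`. -/
noncomputable def UnitaryRep.conj {N : Subgroup G} [N.Normal] {n : ℕ} (σ : UnitaryRep N n) (g : G) :
    UnitaryRep N n :=
  σ.comp (conjHom N g⁻¹)

/-- The irreducible unitary representations `σ` of `N` (on some `ℂⁿ`) with finite image and such
that the `H`-orbit of the equivalence class of `σ` is finite. -/
structure FinitePeriodicIrrep (N H : Subgroup G) [N.Normal] where
  dim : ℕ
  rep : UnitaryRep N dim
  irreducible : rep.toRepresentation.IsIrreducible
  finite_image : (Set.range rep).Finite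
  finite_orbit :
    (Set.range fun h : H => (Quotient.mk (UnitaryRep.setoid N dim) (rep.conj (h : G)))).Finite

section

variable {PN : Type u} [Group PN] [TopologicalSpace PN]

/-- The subgroup `D` of `Prof(N)`: the intersection of the kernels of `Prof(σ)` over all
irreducible unitary representations `σ` of `N` with finite image and finite `H`-orbit. -/
noncomputable def periodicKernel {N : Subgroup G} [N.Normal] (H : Subgroup G) {αN : N →ₜ* PN}
    (hN : IsProfiniteCompletion αN) : Subgroup PN :=
  ⨅ σ : FinitePeriodicIrrep N H, (UnitaryRep.prof hN σ.rep σ.finite_image).toMonoidHom.ker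

instance periodicKernel_normal {N : Subgroup G} [N.Normal] (H : Subgroup G) {αN : N →ₜ* PN}
    (hN : IsProfiniteCompletion αN) : (periodicKernel H hN).Normal :=
  Subgroup.normal_iInf_normal fun _ => inferInstance

/-- The continuous endomorphism of `Prof(N)` induced by conjugation with `g`. -/
noncomputable def profConj {N : Subgroup G} [N.Normal] [IsProfiniteGroup PN] {αN : N →ₜ* PN}
    (hN : IsProfiniteCompletion αN) (g : G) : PN →ₜ* PN :=
  hN.lift (αN.comp (conjHom N g))

theorem profConj_apply {N : Subgroup G} [N.Normal] [IsProfiniteGroup PN] {αN : N →ₜ* PN}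
    (hN : IsProfiniteCompletion αN) (g : G) (x : N) :
    profConj hN g (αN x) = αN (conjHom N g x) :=
  hN.lift_apply _ x

theorem profConj_one {N : Subgroup G} [N.Normal] [IsProfiniteGroup PN] {αN : N →ₜ* PN}
    (hN : IsProfiniteCompletion αN) : profConj hN 1 = ContinuousMonoidHom.id PN := by
  refine hN.hom_ext fun x => ?_
  rw [profConj_apply]
  change αN _ = αN x
  congr 1
  ext1
  simp [conjHom_apply]

theorem profConj_mul {N : Subgroup G} [N.Normal] [IsProfiniteGroup PN] {αN : N →ₜ* PN}
    (hN : IsProfiniteCompletion αN) (g g' : G) :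
    profConj hN (g * g') = (profConj hN g).comp (profConj hN g') := by
  refine hN.hom_ext fun x => ?_
  change _ = profConj hN g (profConj hN g' (αN x))
  rw [profConj_apply, profConj_apply, profConj_apply]
  congr 1
  ext1
  simp [conjHom_apply, mul_assoc]

/-- The action `θ` of `H` on `Prof(N)` by automorphisms (continuous, see
`continuous_profAction`), characterized by `θ(h)(α_N(x)) = α_N(h x h⁻¹)`. -/
noncomputable def profAction {N : Subgroup G} [N.Normal] (H : Subgroup G) [IsProfiniteGroup PN]
    {αN : N →ₜ* PN} (hN : IsProfiniteCompletion αN) : H →* MulAut PN where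
  toFun h :=
    { toFun := profConj hN (h : G)
      invFun := profConj hN (h : G)⁻¹
      left_inv := fun x => by
        have := DFunLike.congr_fun (profConj_mul hN (h : G)⁻¹ (h : G)) x
        rw [inv_mul_cancel, profConj_one] at this
        exact this.symm
      right_inv := fun x => by
        have := DFunLike.congr_fun (profConj_mul hN (h : G) (h : G)⁻¹) x
        rw [mul_inv_cancel, profConj_one] at this
        exact this.symm
      map_mul' := map_mul _ }
  map_one' := by
    ext x
    exact DFunLike.congr_fun (profConj_one hN) x
  map_mul' h h' := by
    ext x
    exact DFunLike.congr_fun (profConj_mul hN (h : G) (h' : G)) x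

theorem profAction_apply {N : Subgroup G} [N.Normal] (H : Subgroup G) [IsProfiniteGroup PN]
    {αN : N →ₜ* PN} (hN : IsProfiniteCompletion αN) (h : H) (x : N) :
    profAction H hN h (αN x) = αN (conjHom N (h : G) x) :=
  profConj_apply hN (h : G) x

theorem continuous_profAction {N : Subgroup G} [N.Normal] (H : Subgroup G) [IsProfiniteGroup PN]
    {αN : N →ₜ* PN} (hN : IsProfiniteCompletion αN) (h : H) :
    Continuous (profAction H hN h) :=
  map_continuous (profConj hN (h : G))

end

/-! ### The closure of the image of a subgroup in `Prof(G)` -/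

variable {PG : Type u} [Group PG] [TopologicalSpace PG] [IsProfiniteGroup PG]

/-- The closure of `α(S)`. -/
def closureImage (α : G →ₜ* PG) (S : Subgroup G) : Subgroup PG :=
  (S.map α.toMonoidHom).topologicalClosure

instance closureImage_isProfiniteGroup (α : G →ₜ* PG) (S : Subgroup G) :
    IsProfiniteGroup (closureImage α S) :=
  have : CompactSpace (closureImage α S) :=
    isCompact_iff_compactSpace.mp (Subgroup.isClosed_topologicalClosure _).isCompact
  { }

/-- The restriction of `α` to `S`, as a map to the closure of `α(S)`. -/
def restrictToClosure (α : G →ₜ* PG) (S : Subgroup G) : S →ₜ* closureImage α S where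
  toFun s := ⟨α s, Subgroup.le_topologicalClosure _ ⟨s, s.2, rfl⟩⟩
  map_one' := Subtype.ext (map_one α)
  map_mul' s t := Subtype.ext (map_mul α (s : G) (t : G))
  continuous_toFun := ((map_continuous α).comp continuous_subtype_val).subtype_mk _

/-- The map `ψ_S : Prof(S) → closure of α_G(S)` characterized by `ψ_S ∘ α_S = α_G|_S`. -/
noncomputable def psi {S : Subgroup G} {PS : Type u} [Group PS] [TopologicalSpace PS]
    {αS : S →ₜ* PS} (hS : IsProfiniteCompletion αS) (α : G →ₜ* PG) : PS →ₜ* closureImage α S :=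
  hS.lift (restrictToClosure α S)

theorem psi_apply {S : Subgroup G} {PS : Type u} [Group PS] [TopologicalSpace PS]
    {αS : S →ₜ* PS} (hS : IsProfiniteCompletion αS) (α : G →ₜ* PG) (s : S) :
    (psi hS α (αS s) : PG) = α s :=
  congrArg Subtype.val (hS.lift_apply (restrictToClosure α S) s)

end Extension

/-! Everything rests on comparing finite quotients of N with those of G. A finite quotient of G
restricts to N with an H-invariant kernel. Conversely, an H-invariant open subgroup U of finite
index in N gives the open subgroup U ⋊ H of finite index in G, whose normal core meets N inside U
(`exists_openNormal`). So Ker ψ_N is governed by the H-invariant open subgroups of finite index in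
N, and representations translate this into D.

If σ has finite image and finite H-orbit, the common kernel of its conjugates is a finite
intersection, hence such an invariant subgroup; this gives Ker ψ_N ≤ D
(`ker_psi_le_periodicKernel`). In the other direction, a point outside an H-invariant open normal U
of finite index is detected by an irreducible constituent of the permutation representation on N/U.
That constituent is trivial on U, so its image and its orbit are finite; this gives D ≤ Ker ψ_N
(`periodicKernel_le_ker_psi`).

The retraction G → H with kernel N extends to Prof(G) → Prof(H). It is a left inverse of ψ_H and
kills the closure of α_G(N) (`profRetraction_psi`, `profRetraction_closureImage`). Hence ψ_H is
injective and the two closures meet trivially. Their product is compact and contains the dense image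
of G = NH, so it is all of Prof(G). Compactness makes every continuous bijective homomorphism
obtained here a topological isomorphism. -/

/-! ### Irreducible representations separating points from open subgroups -/

open scoped InnerProductSpace in
/-- A unitary representation that is nontrivial at `a` has an irreducible constituent that is
nontrivial at `a`. -/
theorem UnitaryRep.exists_irreducible {F : Type u} [Group F] [TopologicalSpace F]
    [IsTopologicalGroup F] {E : Type v} [NormedAddCommGroup E] [InnerProductSpace ℂ E]
    [FiniteDimensional ℂ E] (ρ : F →* (E ≃ₗᵢ[ℂ] E)) (hρ : IsOpen (ρ.ker : Set F)) {a : F}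
    (ha : ρ a ≠ 1) :
    ∃ (n : ℕ) (σ : UnitaryRep F n), σ.toRepresentation.IsIrreducible ∧ σ a ≠ 1 ∧
      ∀ g, ρ g = 1 → σ g = 1 := by
  -- Invariant subspaces on which `a` still acts nontrivially. A minimal one is irreducible: `a`
  -- would act trivially on a proper nonzero invariant subspace and on its orthogonal complement,
  -- hence on their sum.
  let P : Submodule ℂ E → Prop := fun W =>
    (∀ g, ∀ w ∈ W, ρ g w ∈ W) ∧ ∃ w ∈ W, ρ a w ≠ w
  have hP : P ⊤ := by
    refine ⟨fun _ _ _ => trivial, ?_⟩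
    by_contra! h
    exact ha (LinearIsometryEquiv.ext fun w => h w trivial)
  obtain ⟨W, ⟨hW, w₀, hw₀, hne⟩, hmin⟩ :=
    (wellFounded_lt (α := Submodule ℂ E)).has_min {W | P W} ⟨⊤, hP⟩
  let n := Module.finrank ℂ W
  let b : OrthonormalBasis (Fin n) ℂ W := stdOrthonormalBasis ℂ W
  let f : F →* (W →ₗ[ℂ] W) :=
    { toFun := fun g => ((ρ g).toLinearEquiv.toLinearMap).restrict (hW g)
      map_one' := by ext w; simp
      map_mul' := fun g h => by ext w; simp }
  have hf (g : F) (w : W) : (f g w : E) = ρ g w := rfl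
  have hu (g : F) : LinearMap.toMatrixOrthonormal b (f g) ∈ Matrix.unitaryGroup (Fin n) ℂ := by
    have : star (f g) * f g = 1 := by
      refine LinearMap.ext fun w => ext_inner_left ℂ fun w' => ?_
      rw [Module.End.mul_apply, LinearMap.star_eq_adjoint, LinearMap.adjoint_inner_right]
      exact (ρ g).inner_map_map _ _
    rw [Matrix.mem_unitaryGroup_iff', ← map_star, ← map_mul, this, map_one]
  let σ₀ : F →* Matrix.unitaryGroup (Fin n) ℂ :=
    { toFun := fun g => ⟨LinearMap.toMatrixOrthonormal b (f g), hu g⟩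
      map_one' := Subtype.ext (by
        change LinearMap.toMatrixOrthonormal b (f 1) = 1
        rw [map_one, map_one])
      map_mul' := fun g h => Subtype.ext (by
        change LinearMap.toMatrixOrthonormal b (f (g * h)) =
          LinearMap.toMatrixOrthonormal b (f g) * LinearMap.toMatrixOrthonormal b (f h)
        rw [map_mul, map_mul]) }
  have hker (g : F) (hg : ρ g = 1) : σ₀ g = 1 := by
    refine Subtype.ext ?_
    change LinearMap.toMatrixOrthonormal b (f g) = 1
    have : f g = 1 := LinearMap.ext fun w => Subtype.ext (by rw [hf, hg]; rfl)
    rw [this, map_one]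
  -- The homomorphism is constant on the open kernel of `ρ`, and continuity at 1 suffices.
  have hcont : Continuous σ₀ := by
    refine continuous_of_continuousAt_one σ₀ ?_
    have hev : σ₀ =ᶠ[nhds 1] fun _ => 1 := by
      filter_upwards [hρ.mem_nhds (one_mem ρ.ker)] with g hg using hker g hg
    exact (continuousAt_const.congr hev.symm)
  let σ : UnitaryRep F n := { toMonoidHom := σ₀, continuous_toFun := hcont }
  -- An injective intertwiner from the matrix representation onto `W`; it carries subrepresentations
  -- of `σ` to invariant subspaces of `E`, where minimality applies.
  let T : (Fin n → ℂ) →ₗ[ℂ] E := W.subtype ∘ₗ b.toBasis.equivFun.symm.toLinearMap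
  have hTinj : Function.Injective T :=
    W.injective_subtype.comp b.toBasis.equivFun.symm.injective
  have hTW (v : Fin n → ℂ) : T v ∈ W := Subtype.coe_prop _
  have hTsurj (w : E) (hw : w ∈ W) : ∃ v, T v = w :=
    ⟨b.toBasis.equivFun ⟨w, hw⟩, by simp [T]⟩
  have hT (g : F) (v : Fin n → ℂ) : T (σ.toRepresentation g v) = ρ g (T v) := by
    have h1 : σ.toRepresentation g v = (LinearMap.toMatrix b.toBasis b.toBasis (f g)).mulVec v := rfl
    rw [h1]
    have h2 := LinearMap.toMatrix_mulVec_repr b.toBasis b.toBasis (f g)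
      (b.toBasis.equivFun.symm v)
    rw [← Module.Basis.equivFun_apply, LinearEquiv.apply_symm_apply] at h2
    rw [h2, ← Module.Basis.equivFun_apply]
    change ((b.toBasis.equivFun.symm (b.toBasis.equivFun (f g _)) : W) : E) = _
    rw [LinearEquiv.symm_apply_apply]
    rfl
  refine ⟨n, σ, ?_, ?_, hker⟩
  · have hnt : Nontrivial (Subrepresentation σ.toRepresentation) := by
      refine ⟨⊥, ⊤, fun h => hne ?_⟩
      obtain ⟨v, rfl⟩ := hTsurj w₀ hw₀
      have hv : v ∈ (⊥ : Submodule ℂ (Fin n → ℂ)) := by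
        have : (⊥ : Submodule ℂ (Fin n → ℂ)) = ⊤ := congrArg Subrepresentation.toSubmodule h
        rw [this]; trivial
      rw [(Submodule.mem_bot ℂ).mp hv]
      simp
    refine { eq_bot_or_eq_top := fun S => ?_ }
    by_contra! hS
    obtain ⟨hbot, htop⟩ := hS
    let W₁ : Submodule ℂ E := S.toSubmodule.map T
    have hW₁ : W₁ ≤ W := by rintro _ ⟨v, _, rfl⟩; exact hTW v
    have hinv₁ (g : F) : ∀ w ∈ W₁, ρ g w ∈ W₁ := by
      rintro _ ⟨v, hv, rfl⟩
      exact ⟨_, S.apply_mem_toSubmodule g hv, hT g v⟩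
    have hlt₁ : W₁ < W := by
      refine lt_of_le_of_ne hW₁ fun h => htop (Subrepresentation.toSubmodule_injective ?_)
      refine Submodule.eq_top_iff'.mpr fun v => ?_
      obtain ⟨v', hv', e⟩ : T v ∈ W₁ := h ▸ hTW v
      exact hTinj e ▸ hv'
    have hlt₂ : W₁ᗮ ⊓ W < W := by
      refine lt_of_le_of_ne inf_le_right fun h => hbot (Subrepresentation.toSubmodule_injective ?_)
      refine (Submodule.eq_bot_iff _).mpr fun v hv => hTinj ?_
      have h1 : T v ∈ W₁ᗮ := (h.symm ▸ hTW v : T v ∈ W₁ᗮ ⊓ W).1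
      rw [map_zero]
      exact inner_self_eq_zero.mp ((Submodule.mem_orthogonal _ _).mp h1 _ ⟨v, hv, rfl⟩)
    have htriv (W' : Submodule ℂ E) (hlt : W' < W) (hinv : ∀ g, ∀ w ∈ W', ρ g w ∈ W') :
        ∀ w ∈ W', ρ a w = w := by
      by_contra! h
      exact hmin W' ⟨hinv, h⟩ hlt
    have hinv₂ (g : F) : ∀ w ∈ W₁ᗮ ⊓ W, ρ g w ∈ W₁ᗮ ⊓ W := by
      rintro w ⟨h1, h2⟩
      refine ⟨(Submodule.mem_orthogonal _ _).mpr fun y hy => ?_, hW g w h2⟩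
      have hw' : ρ g⁻¹ (ρ g w) = w := by
        change (ρ g⁻¹ * ρ g) w = w
        rw [← map_mul, inv_mul_cancel, map_one]; rfl
      rw [← (ρ g⁻¹).inner_map_map, hw']
      exact (Submodule.mem_orthogonal _ _).mp h1 _ (hinv₁ g⁻¹ y hy)
    have hsup : W₁ ⊔ W₁ᗮ ⊓ W = W := Submodule.sup_orthogonal_inf_of_hasOrthogonalProjection hW₁
    rw [← hsup] at hw₀
    obtain ⟨x, hx, y, hy, rfl⟩ := Submodule.mem_sup.mp hw₀
    exact hne (by rw [map_add, htriv _ hlt₁ hinv₁ x hx, htriv _ hlt₂ hinv₂ y hy])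
  · intro h
    obtain ⟨v, rfl⟩ := hTsurj w₀ hw₀
    refine hne ?_
    rw [← hT]
    congr 1
    have : σ.toRepresentation a = 1 := by
      change Matrix.toLinAlgEquiv' (σ a).1 = 1
      rw [h]
      exact map_one _
    rw [this]; rfl

/-- Irreducible unitary representations that are trivial on an open normal subgroup of finite index
separate it from its complement. -/
theorem UnitaryRep.exists_irreducible_of_notMem {F : Type u} [Group F] [TopologicalSpace F]
    [IsTopologicalGroup F] (U : Subgroup F) [U.Normal] [U.FiniteIndex] (hU : IsOpen (U : Set F))
    {a : F} (ha : a ∉ U) :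
    ∃ (n : ℕ) (σ : UnitaryRep F n), σ.toRepresentation.IsIrreducible ∧ σ a ≠ 1 ∧
      ∀ g ∈ U, σ g = 1 := by
  classical
  have : Fintype (F ⧸ U) := Fintype.ofFinite _
  -- The permutation representation on functions on F/U. Since `U` is normal, it acts trivially; `a`
  -- moves the indicator function of the trivial coset.
  let ρ : F →* (EuclideanSpace ℂ (F ⧸ U) ≃ₗᵢ[ℂ] EuclideanSpace ℂ (F ⧸ U)) :=
    { toFun := fun g => LinearIsometryEquiv.piLpCongrLeft 2 ℂ ℂ (MulAction.toPerm g)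
      map_one' := by
        ext v x
        simp [LinearIsometryEquiv.piLpCongrLeft_apply, Equiv.piCongrLeft'_apply]
      map_mul' := fun g h => by
        ext v x
        simp [LinearIsometryEquiv.piLpCongrLeft_apply, Equiv.piCongrLeft'_apply, mul_smul] }
  have hρ (g : F) (v) (x : F ⧸ U) : ρ g v x = v (g⁻¹ • x) := rfl
  have hρU (g : F) (hg : g ∈ U) : ρ g = 1 := by
    ext v x
    rw [hρ]
    induction x using QuotientGroup.induction_on with
    | H y =>
      change v ((g⁻¹ * y : F) : F ⧸ U) = v y
      rw [QuotientGroup.mk_mul, (QuotientGroup.eq_one_iff g⁻¹).mpr (inv_mem hg), one_mul]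
  have hopen : IsOpen (ρ.ker : Set F) := Subgroup.isOpen_mono (H₁ := U) (fun g hg => hρU g hg) hU
  have ha' : ρ a ≠ 1 := by
    intro h
    have h1 := congrArg (fun e => e (EuclideanSpace.single (1 : F ⧸ U) (1 : ℂ)) (a : F ⧸ U)) h
    change EuclideanSpace.single (1 : F ⧸ U) (1 : ℂ) ((a⁻¹ * a : F) : F ⧸ U) =
      EuclideanSpace.single (1 : F ⧸ U) (1 : ℂ) (a : F ⧸ U) at h1
    have h2 : (a : F ⧸ U) ≠ 1 := fun h => ha ((QuotientGroup.eq_one_iff a).mp h)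
    rw [inv_mul_cancel, QuotientGroup.mk_one] at h1
    simp [h2] at h1
  obtain ⟨n, σ, h1, h2, h3⟩ := UnitaryRep.exists_irreducible ρ hopen ha'
  exact ⟨n, σ, h1, h2, fun g hg => h3 g (hρU g hg)⟩

/-! ### Compactness and topological isomorphisms -/

/-- A continuous bijective homomorphism from a compact group to a Hausdorff group is an isomorphism
of topological groups. -/
theorem MonoidHom.exists_continuousMulEquiv {A : Type u} {B : Type v} [Group A]
    [TopologicalSpace A] [CompactSpace A] [Group B] [TopologicalSpace B] [T2Space B] (f : A →* B)
    (hf : Continuous f) (hb : Function.Bijective f) : ∃ e : A ≃ₜ* B, ∀ a, e a = f a :=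
  let e := MulEquiv.ofBijective f hb
  ⟨{ e with
      continuous_toFun := hf
      continuous_invFun :=
        (Continuous.homeoOfEquivCompactToT2 (f := e.toEquiv) hf).continuous_symm }, fun _ => rfl⟩

instance SemidirectProduct.instCompactSpaceProd {N : Type u} {H : Type v} [Group N] [Group H]
    [TopologicalSpace N] [TopologicalSpace H] [CompactSpace N] [CompactSpace H]
    (φ : H →* MulAut N) : CompactSpace (N ⋊[φ] H) := by
  let e : N ⋊[φ] H ≃ N × H := SemidirectProduct.equivProd
  have he : Topology.IsInducing e := ⟨rfl⟩
  refine ⟨he.isCompact_iff.mpr ?_⟩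
  rw [Set.image_univ, e.surjective.range_eq]
  exact isCompact_univ

theorem SemidirectProduct.continuous_left_right {N : Type u} {H : Type v} [Group N] [Group H]
    [TopologicalSpace N] [TopologicalSpace H] (φ : H →* MulAut N) :
    Continuous fun a : N ⋊[φ] H => (a.left, a.right) :=
  continuous_induced_dom

/-! ### Retraction and finite-index subgroups of N ⋊ H -/

namespace IsTopologicalSemidirectProduct

variable {G : Type u} [Group G] [TopologicalSpace G]

/-- The decomposition of `G` as a product. -/
noncomputable def homeo {N H : Subgroup G} (h : IsTopologicalSemidirectProduct N H) :
    N × H ≃ₜ G :=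
  h.isHomeomorph.homeomorph

theorem homeo_apply {N H : Subgroup G} (h : IsTopologicalSemidirectProduct N H) (x : N) (y : H) :
    h.homeo (x, y) = x * y := rfl

theorem homeo_symm_mul {N H : Subgroup G} (h : IsTopologicalSemidirectProduct N H)
    (x : N) (y : H) : h.homeo.symm ((x : G) * y) = (x, y) := by
  rw [← h.homeo_apply, Homeomorph.symm_apply_apply]

theorem exists_eq_mul {N H : Subgroup G} (h : IsTopologicalSemidirectProduct N H) (g : G) :
    ∃ (x : N) (y : H), g = x * y :=
  ⟨_, _, (h.homeo.apply_symm_apply g).symm⟩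

omit [TopologicalSpace G] in
theorem mul_mul_mul_eq {N H : Subgroup G} [N.Normal] (x x' : N) (y y' : H) :
    (x : G) * y * (x' * y') = ((x * MulAut.conjNormal (y : G) x' : N) : G) * ((y * y' : H) : G) := by
  simp [mul_assoc]

/-- The retraction of `G` onto `H` with kernel `N`. -/
noncomputable def retraction {N H : Subgroup G} (h : IsTopologicalSemidirectProduct N H) :
    G →ₜ* H where
  toFun g := (h.homeo.symm g).2
  map_one' := by
    have := h.homeo_symm_mul 1 1
    rw [OneMemClass.coe_one, OneMemClass.coe_one, one_mul] at this
    rw [this]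
  map_mul' g g' := by
    have := h.normal
    obtain ⟨x, y, rfl⟩ := h.exists_eq_mul g
    obtain ⟨x', y', rfl⟩ := h.exists_eq_mul g'
    rw [mul_mul_mul_eq, homeo_symm_mul, homeo_symm_mul, homeo_symm_mul]
  continuous_toFun := continuous_snd.comp h.homeo.symm.continuous

theorem retraction_mul {N H : Subgroup G} (h : IsTopologicalSemidirectProduct N H)
    (x : N) (y : H) : h.retraction (x * y) = y :=
  congrArg Prod.snd (h.homeo_symm_mul x y)

theorem retraction_left {N H : Subgroup G} (h : IsTopologicalSemidirectProduct N H)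
    (x : N) : h.retraction (x : G) = 1 := by
  have := h.retraction_mul x 1
  rwa [OneMemClass.coe_one, mul_one] at this

theorem retraction_right {N H : Subgroup G} (h : IsTopologicalSemidirectProduct N H)
    (y : H) : h.retraction (y : G) = y := by
  have := h.retraction_mul 1 y
  rwa [OneMemClass.coe_one, one_mul] at this

/-- The subgroup `U ⋊ H` of `N ⋊ H`, for an `H`-invariant subgroup `U` of `N`. -/
noncomputable def extend {N H : Subgroup G} [N.Normal] (h : IsTopologicalSemidirectProduct N H)
    (U : Subgroup N) (hU : ∀ y : H, ∀ x ∈ U, MulAut.conjNormal (y : G) x ∈ U) : Subgroup G where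
  carrier := {g | (h.homeo.symm g).1 ∈ U}
  one_mem' := by
    have := h.homeo_symm_mul 1 1
    rw [OneMemClass.coe_one, OneMemClass.coe_one, one_mul] at this
    rw [Set.mem_ofPred_eq, this]
    exact one_mem U
  mul_mem' {g g'} hg hg' := by
    obtain ⟨x, y, rfl⟩ := h.exists_eq_mul g
    obtain ⟨x', y', rfl⟩ := h.exists_eq_mul g'
    rw [Set.mem_ofPred_eq, homeo_symm_mul] at hg hg'
    rw [Set.mem_ofPred_eq, mul_mul_mul_eq, homeo_symm_mul]
    exact mul_mem hg (hU y _ hg')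
  inv_mem' {g} hg := by
    obtain ⟨x, y, rfl⟩ := h.exists_eq_mul g
    rw [Set.mem_ofPred_eq, homeo_symm_mul] at hg
    have : ((x : G) * y)⁻¹ = (MulAut.conjNormal ((y⁻¹ : H) : G) x⁻¹ : N) * (y⁻¹ : H) := by
      simp [mul_assoc]
    rw [Set.mem_ofPred_eq, this, homeo_symm_mul]
    exact hU _ _ (inv_mem hg)

section extend

variable {N H : Subgroup G} [N.Normal] (h : IsTopologicalSemidirectProduct N H)
    {U : Subgroup N} (hU : ∀ y : H, ∀ x ∈ U, MulAut.conjNormal (y : G) x ∈ U)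

theorem mul_mem_extend {x : N} {y : H} : (x : G) * y ∈ h.extend U hU ↔ x ∈ U := by
  change (h.homeo.symm _).1 ∈ U ↔ _
  rw [homeo_symm_mul]

theorem coe_mem_extend {x : N} : (x : G) ∈ h.extend U hU ↔ x ∈ U := by
  rw [← h.mul_mem_extend hU (y := 1), OneMemClass.coe_one, mul_one]

theorem isOpen_extend (hUo : IsOpen (U : Set N)) : IsOpen (h.extend U hU : Set G) :=
  hUo.preimage (continuous_fst.comp h.homeo.symm.continuous)

/-- Since U ⋊ H contains H, every coset of it is represented by an element of N, so N/U maps onto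
the coset space. -/
theorem finiteIndex_extend [U.FiniteIndex] : (h.extend U hU).FiniteIndex := by
  let f : N ⧸ U → G ⧸ h.extend U hU := Quotient.map' Subtype.val fun x x' hx => by
    rw [QuotientGroup.leftRel_apply] at hx ⊢
    exact (h.coe_mem_extend hU (x := x⁻¹ * x')).mpr hx
  have hf : Function.Surjective f := by
    intro q
    induction q using QuotientGroup.induction_on with
    | H g =>
      obtain ⟨x, y, rfl⟩ := h.exists_eq_mul g
      refine ⟨(x : N ⧸ U), QuotientGroup.eq.mpr ?_⟩
      rw [inv_mul_cancel_left]
      have := (h.mul_mem_extend hU (x := 1) (y := y)).mpr (one_mem U)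
      rwa [OneMemClass.coe_one, one_mul] at this
  have := Finite.of_surjective f hf
  exact Subgroup.finiteIndex_of_finite_quotient

end extend

/-- An `H`-invariant open subgroup of finite index of `N` contains the trace of an open normal
subgroup of finite index of `N ⋊ H`. -/
theorem exists_openNormal [IsTopologicalGroup G] {N H : Subgroup G} [N.Normal]
    (h : IsTopologicalSemidirectProduct N H) (U : Subgroup N) [U.FiniteIndex]
    (hUo : IsOpen (U : Set N)) (hU : ∀ y : H, ∀ x ∈ U, MulAut.conjNormal (y : G) x ∈ U) :
    ∃ W : Subgroup G, W.Normal ∧ W.FiniteIndex ∧ IsOpen (W : Set G) ∧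
      ∀ x : N, (x : G) ∈ W → x ∈ U := by
  have := h.finiteIndex_extend hU
  refine ⟨(h.extend U hU).normalCore, inferInstance, inferInstance, ?_, fun x hx =>
    (h.coe_mem_extend hU).mp (Subgroup.normalCore_le _ hx)⟩
  -- The normal core is an intersection of closed conjugates, hence closed, and a closed subgroup of
  -- finite index is open.
  exact Subgroup.isOpen_of_isClosed_of_finiteIndex _
    (Subgroup.normalCore_isClosed _ (Subgroup.isClosed_of_isOpen _ (h.isOpen_extend hU hUo)))

end IsTopologicalSemidirectProduct

/-! ### The kernel of ψ_N -/

/-- An open subgroup of a profinite completion is killed by a continuous homomorphism as soon as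
its trace on the original group is. -/
theorem IsProfiniteCompletion.eq_one_of_mem {S P M : Type*} [Group S] [TopologicalSpace S]
    [Group P] [TopologicalSpace P] {α : S →ₜ* P} (hα : DenseRange α)
    [Group M] [TopologicalSpace M] [T2Space M] (f : P →ₜ* M) {V : Subgroup P}
    (hV : IsOpen (V : Set P)) (h : ∀ s, α s ∈ V → f (α s) = 1) {p : P} (hp : p ∈ V) :
    f p = 1 := by
  have hcl : IsClosed {p | f p = 1} := isClosed_eq (map_continuous f) continuous_const
  -- Because V is open, the part of the dense image lying in V is dense in V.
  refine closure_minimal ?_ hcl (hα.open_subset_closure_inter hV hp)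
  rintro _ ⟨hs, s, rfl⟩
  exact h s hs

theorem MonoidHom.finite_range_of_finiteIndex_ker {A : Type u} {B : Type v} [Group A] [Group B]
    (f : A →* B) [f.ker.FiniteIndex] : (Set.range f).Finite := by
  have : Nat.card f.range ≠ 0 := Subgroup.index_ker f ▸ Subgroup.FiniteIndex.index_ne_zero
  exact Set.finite_coe_iff.mp (Nat.finite_of_card_ne_zero this)

section Kernel

variable {G : Type u} [Group G] [TopologicalSpace G] [IsTopologicalGroup G]
  {N H : Subgroup G} [N.Normal]

/-- An irreducible unitary representation that is trivial on an `H`-invariant subgroup of finite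
index has finite image and a finite `H`-orbit. -/
def FinitePeriodicIrrep.ofFiniteIndex (H : Subgroup G) (U : Subgroup N) [U.FiniteIndex]
    (hU : ∀ y : H, ∀ x ∈ U, MulAut.conjNormal (y : G) x ∈ U) {n : ℕ} (σ : UnitaryRep N n)
    (hirr : σ.toRepresentation.IsIrreducible) (hσ : ∀ x ∈ U, σ x = 1) :
    FinitePeriodicIrrep N H where
  dim := n
  rep := σ
  irreducible := hirr
  finite_image := by
    have : U ≤ σ.toMonoidHom.ker := hσ
    have := Subgroup.finiteIndex_of_le this
    exact σ.toMonoidHom.finite_range_of_finiteIndex_ker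
  finite_orbit := by
    have : U ≤ σ.toMonoidHom.ker := hσ
    have := Subgroup.finiteIndex_of_le this
    have hfin : Finite σ.toMonoidHom.range := σ.toMonoidHom.finite_range_of_finiteIndex_ker.to_subtype
    -- Every H-conjugate of `σ` lies in `S`, by invariance of `U`. A member of `S` is determined by
    -- a map from the finite set N/U to the finite image of `σ`, so even the orbit before passing to
    -- equivalence classes is finite.
    let S : Set (UnitaryRep N n) := {τ | (∀ x ∈ U, τ x = 1) ∧ ∀ x, τ x ∈ σ.toMonoidHom.range}
    have hS : S.Finite := by
      let F : S → (N ⧸ U → σ.toMonoidHom.range) := fun τ q => ⟨τ.1 q.out, τ.2.2 _⟩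
      refine Set.finite_coe_iff.mp (Finite.of_injective F fun τ τ' h => ?_)
      refine Subtype.ext (ContinuousMonoidHom.ext fun x => ?_)
      have key (ρ : S) : ρ.1 x = F ρ (x : N ⧸ U) := by
        obtain ⟨u, hu⟩ := QuotientGroup.mk_out_eq_mul U x
        change ρ.1 x = ρ.1 (Quotient.out (x : N ⧸ U))
        rw [hu, map_mul, ρ.2.1 u u.2, mul_one]
      rw [key, key, h]
    refine (hS.image (Quotient.mk (UnitaryRep.setoid N n))).subset ?_
    rintro _ ⟨y, rfl⟩
    refine ⟨σ.conj (y : G), ⟨fun x hx => ?_, fun x => ⟨_, rfl⟩⟩, rfl⟩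
    exact hσ _ (hU y⁻¹ x hx)

namespace FinitePeriodicIrrep

variable (σ : FinitePeriodicIrrep N H)

/-- The common kernel of the conjugates of `σ` under `H`. -/
noncomputable def orbitKernel : Subgroup N :=
  ⨅ y : H, (σ.rep.conj (y : G)).toMonoidHom.ker

theorem mem_orbitKernel {x : N} :
    x ∈ σ.orbitKernel ↔ ∀ y : H, σ.rep (MulAut.conjNormal (y : G)⁻¹ x) = 1 := by
  simp only [orbitKernel, Subgroup.mem_iInf]
  rfl

theorem rep_eq_one_of_mem_orbitKernel {x : N} (hx : x ∈ σ.orbitKernel) : σ.rep x = 1 := by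
  simpa using σ.mem_orbitKernel.mp hx 1

theorem conj_mem_orbitKernel (y : H) (x : N) (hx : x ∈ σ.orbitKernel) :
    MulAut.conjNormal (y : G) x ∈ σ.orbitKernel := by
  rw [mem_orbitKernel] at hx ⊢
  intro z
  have h1 : MulAut.conjNormal (z : G)⁻¹ (MulAut.conjNormal (y : G) x) =
      MulAut.conjNormal ((y⁻¹ * z : H) : G)⁻¹ x :=
    Subtype.ext (by simp [mul_assoc])
  rw [h1]
  exact hx (y⁻¹ * z)

/-- Unitarily equivalent representations have the same kernel, so a finite orbit of classes produces
only finitely many kernels. -/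
theorem finite_range_ker_conj :
    (Set.range fun y : H => (σ.rep.conj (y : G)).toMonoidHom.ker).Finite := by
  let κ : Quotient (UnitaryRep.setoid N σ.dim) → Subgroup N :=
    Quotient.lift (fun τ => τ.toMonoidHom.ker) (by
      rintro τ τ' ⟨U, hU⟩
      refine Subgroup.ext fun x => ?_
      change τ x = 1 ↔ τ' x = 1
      rw [← hU, conj_eq_one_iff])
  refine (σ.finite_orbit.image κ).subset ?_
  rintro _ ⟨y, rfl⟩
  exact ⟨_, ⟨y, rfl⟩, rfl⟩

theorem finiteIndex_ker_conj (g : G) : (σ.rep.conj g).toMonoidHom.ker.FiniteIndex := by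
  have : Finite (σ.rep.conj g).toMonoidHom.range := by
    refine (σ.finite_image.subset ?_).to_subtype
    rintro _ ⟨x, rfl⟩
    exact ⟨_, rfl⟩
  exact Subgroup.finiteIndex_ker _

instance finiteIndex_orbitKernel : σ.orbitKernel.FiniteIndex := by
  have := σ.finite_range_ker_conj.to_subtype
  -- Indexing by the distinct kernels rather than by H makes the intersection finite.
  rw [orbitKernel, ← sInf_range, sInf_eq_iInf']
  refine Subgroup.finiteIndex_iInf ?_
  rintro ⟨_, y, rfl⟩
  exact σ.finiteIndex_ker_conj _

theorem isOpen_orbitKernel : IsOpen (σ.orbitKernel : Set N) := by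
  refine Subgroup.isOpen_of_isClosed_of_finiteIndex _ ?_
  rw [orbitKernel, Subgroup.coe_iInf]
  exact isClosed_iInter fun y =>
    isClosed_singleton.preimage (map_continuous (σ.rep.conj (y : G)))

end FinitePeriodicIrrep

variable {PG PN : Type u} [Group PG] [TopologicalSpace PG] [IsProfiniteGroup PG]
  [Group PN] [TopologicalSpace PN]

/-- The orbit kernel of σ contains the trace on N of an open normal subgroup W of finite index in G.
The quotient G/W factors through Prof(G), so its restriction to N sees ψ_N only, and it is fine
enough to control σ. -/
theorem ker_psi_le_periodicKernel (hNH : IsTopologicalSemidirectProduct N H)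
    {αG : G →ₜ* PG} (hG : IsProfiniteCompletion αG) {αN : N →ₜ* PN}
    (hN : IsProfiniteCompletion αN) :
    (psi hN αG).toMonoidHom.ker ≤ periodicKernel H hN := by
  intro p hp
  refine Subgroup.mem_iInf.mpr fun σ => ?_
  obtain ⟨W, hWn, hWf, hWo, hW⟩ :=
    hNH.exists_openNormal σ.orbitKernel σ.isOpen_orbitKernel σ.conj_mem_orbitKernel
  have : DiscreteTopology (G ⧸ W) := QuotientGroup.discreteTopology hWo
  have : IsProfiniteGroup (G ⧸ W) := { }
  let q : G →ₜ* (G ⧸ W) :=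
    { toMonoidHom := QuotientGroup.mk' W, continuous_toFun := continuous_quotient_mk' }
  let f : PN →* (G ⧸ W) :=
    (hG.lift q).toMonoidHom.comp ((closureImage αG N).subtype.comp (psi hN αG).toMonoidHom)
  have hf : Continuous f :=
    (map_continuous (hG.lift q)).comp (continuous_subtype_val.comp (map_continuous (psi hN αG)))
  -- Prof(σ) is trivial on all of the kernel of `f`, which contains Ker ψ_N. That kernel is open, so
  -- this can be tested on elements of N, where it means lying in `W`.
  refine IsProfiniteCompletion.eq_one_of_mem hN.denseRange
    (UnitaryRep.prof hN σ.rep σ.finite_image) (V := f.ker)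
    ((isOpen_discrete {1}).preimage hf) (fun x hx => ?_) ?_
  · rw [UnitaryRep.prof_apply]
    refine σ.rep_eq_one_of_mem_orbitKernel (hW x ((QuotientGroup.eq_one_iff _).mp ?_))
    have : hG.lift q (psi hN αG (αN x) : PG) = 1 := hx
    rw [psi_apply, hG.lift_apply] at this
    exact this
  · have : psi hN αG p = 1 := hp
    change hG.lift q (psi hN αG p : PG) = 1
    rw [this]
    exact map_one _

/-- If ψ_N(p) ≠ 1, some open normal subgroup V of Prof(G) misses ψ_N(p). Its trace on N is invariant
under conjugation by H because V is normal, so an irreducible representation of N trivial on that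
trace is admissible in the definition of D, and a suitable one is nontrivial at p. -/
theorem periodicKernel_le_ker_psi (H : Subgroup G) (αG : G →ₜ* PG) {αN : N →ₜ* PN}
    (hN : IsProfiniteCompletion αN) :
    periodicKernel H hN ≤ (psi hN αG).toMonoidHom.ker := by
  intro p hp
  by_contra hne
  have hne' : (psi hN αG p : PG) ≠ 1 := fun h => hne (Subtype.ext h)
  obtain ⟨V, hV⟩ := ProfiniteGrp.exist_openNormalSubgroup_sub_open_nhds_of_one
    (G := PG) (isOpen_compl_singleton (x := (psi hN αG p : PG))) (by simpa using hne'.symm)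
  have : IsProfiniteGroup PN := hN.profinite
  have hVf : V.toSubgroup.FiniteIndex := Subgroup.finiteIndex_of_finite_quotient
  let f : PN →* PG := (closureImage αG N).subtype.comp (psi hN αG).toMonoidHom
  have hf : Continuous f := continuous_subtype_val.comp (map_continuous (psi hN αG))
  let V' : Subgroup PN := V.toSubgroup.comap f
  have hV' : IsOpen (V' : Set PN) := V.isOpen'.preimage hf
  let i : N →* PG := αG.toMonoidHom.comp N.subtype
  have hi : Continuous i := (map_continuous αG).comp continuous_subtype_val
  let U : Subgroup N := V.toSubgroup.comap i
  have hUo : IsOpen (U : Set N) := V.isOpen'.preimage hi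
  have hUf : U.FiniteIndex := by
    refine ⟨?_⟩
    rw [Subgroup.index_comap]
    exact Subgroup.FiniteIndex.index_ne_zero (H := V.toSubgroup.subgroupOf i.range)
  have hfα (x : N) : f (αN x) = i x := psi_apply hN αG x
  have hUinv (y : H) (x : N) (hx : x ∈ U) : MulAut.conjNormal (y : G) x ∈ U := by
    change αG (y * x * (y : G)⁻¹) ∈ V.toSubgroup
    rw [map_mul, map_mul, map_inv]
    exact V.isNormal'.conj_mem _ hx _
  -- Approximates `p` modulo `V'` by an element of N. The representation chosen below extends to one
  -- trivial on `V'`, so its values at `p` and at `x` agree.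
  obtain ⟨x, hx⟩ : ∃ x, p⁻¹ * αN x ∈ V' :=
    hN.denseRange.exists_mem_open (hV'.preimage (continuous_const_mul p⁻¹))
      ⟨p, by simp⟩
  have hxU : x ∉ U := by
    intro h
    refine hV (a := f p) ?_ rfl
    have h1 : f (p⁻¹ * αN x) ∈ V.toSubgroup := hx
    rw [map_mul, hfα, map_inv] at h1
    exact inv_mem_iff.mp ((mul_mem_cancel_right (show i x ∈ V.toSubgroup from h)).mp h1)
  obtain ⟨n, σ, hirr, hσx, hσU⟩ := UnitaryRep.exists_irreducible_of_notMem U hUo hxU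
  let τ := FinitePeriodicIrrep.ofFiniteIndex H U hUinv σ hirr hσU
  have h1 : UnitaryRep.prof hN τ.rep τ.finite_image p = 1 := Subgroup.mem_iInf.mp hp τ
  have h2 : UnitaryRep.prof hN τ.rep τ.finite_image (p⁻¹ * αN x) = 1 := by
    refine IsProfiniteCompletion.eq_one_of_mem hN.denseRange _ hV' (fun z hz => ?_) hx
    rw [UnitaryRep.prof_apply]
    refine hσU z ?_
    have : f (αN z) ∈ V.toSubgroup := hz
    rwa [hfα] at this
  rw [map_mul, map_inv, h1, inv_one, one_mul, UnitaryRep.prof_apply] at h2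
  exact hσx h2

end Kernel

/-! ### Closures of images in Prof(G) -/

section Closure

variable {G : Type u} [Group G] [TopologicalSpace G] [IsTopologicalGroup G]
  {PG : Type u} [Group PG] [TopologicalSpace PG] [IsProfiniteGroup PG]

/-- The image of the compact group Prof(S) is closed and contains α(S). -/
theorem psi_surjective {S : Subgroup G} {PS : Type u} [Group PS] [TopologicalSpace PS]
    {αS : S →ₜ* PS} (hS : IsProfiniteCompletion αS) (α : G →ₜ* PG) :
    Function.Surjective (psi hS α) := by
  have : IsProfiniteGroup PS := hS.profinite
  let f : PS → PG := fun p => psi hS α p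
  have hf : Continuous f := continuous_subtype_val.comp (map_continuous (psi hS α))
  have hsub : (closureImage α S : Set PG) ⊆ Set.range f := by
    refine closure_minimal ?_ (isCompact_range hf).isClosed
    rintro _ ⟨s, hs, rfl⟩
    exact ⟨αS ⟨s, hs⟩, psi_apply hS α ⟨s, hs⟩⟩
  rintro ⟨z, hz⟩
  obtain ⟨p, hp⟩ := hsub hz
  exact ⟨p, Subtype.ext hp⟩

omit [IsTopologicalGroup G] in
-- Two density arguments: the conjugating element is first approximated from α(G) with the
-- conjugated one fixed in α(N), and then the latter is moved through the closure.
theorem closureImage_normal {α : G →ₜ* PG} (hα : DenseRange α) (N : Subgroup G) [hN : N.Normal] :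
    (closureImage α N).Normal := by
  have hcl : IsClosed (closureImage α N : Set PG) := Subgroup.isClosed_topologicalClosure _
  have h1 (p : PG) (x : N) : p * α x * p⁻¹ ∈ closureImage α N := by
    refine hα.induction_on p (p := fun p => p * α x * p⁻¹ ∈ closureImage α N)
      (hcl.preimage (f := fun p => p * α x * p⁻¹) (by fun_prop)) fun g => ?_
    refine Subgroup.le_topologicalClosure _ ⟨g * x * g⁻¹, hN.conj_mem _ x.2 g, ?_⟩
    change α (g * x * g⁻¹) = _
    rw [map_mul, map_mul, map_inv]
  refine ⟨fun m hm p => ?_⟩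
  refine closure_minimal (t := {m | p * m * p⁻¹ ∈ closureImage α N}) ?_
    (hcl.preimage (f := fun m => p * m * p⁻¹) (by fun_prop)) hm
  rintro _ ⟨x, hx, rfl⟩
  exact h1 p ⟨x, hx⟩

/-- Both sides are continuous in p and agree on the dense image of N. This equivariance makes Ker
ψ_N invariant under θ and identifies the induced action with conjugation inside Prof(G). -/
theorem psi_profConj {N : Subgroup G} [N.Normal] {PN : Type u} [Group PN] [TopologicalSpace PN]
    [IsProfiniteGroup PN] {αN : N →ₜ* PN} (hN : IsProfiniteCompletion αN) (α : G →ₜ* PG)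
    (g : G) (p : PN) :
    (psi hN α (profConj hN g p) : PG) = α g * psi hN α p * (α g)⁻¹ := by
  have hψ : Continuous fun p => (psi hN α p : PG) :=
    continuous_subtype_val.comp (map_continuous (psi hN α))
  refine congrFun (hN.denseRange.equalizer (hψ.comp (map_continuous (profConj hN g)))
    (h := fun p => α g * psi hN α p * (α g)⁻¹) (by fun_prop) (funext fun x => ?_)) p
  simp only [Function.comp_apply]
  rw [profConj_apply, psi_apply, psi_apply, conjHom_apply, map_mul, map_mul, map_inv]

end Closure

/-! ### The retraction Prof(G) → Prof(H) -/

section Retraction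

variable {G : Type u} [Group G] [TopologicalSpace G] [IsTopologicalGroup G] {N H : Subgroup G}
  {PG PH : Type u} [Group PG] [TopologicalSpace PG] [IsProfiniteGroup PG]
  [Group PH] [TopologicalSpace PH] [IsProfiniteGroup PH]

/-- The retraction `Prof(G) → Prof(H)` induced by the retraction of `G = N ⋊ H` onto `H`. -/
noncomputable def profRetraction (hNH : IsTopologicalSemidirectProduct N H) {αG : G →ₜ* PG}
    (hG : IsProfiniteCompletion αG) (αH : H →ₜ* PH) : PG →ₜ* PH :=
  hG.lift (αH.comp hNH.retraction)

omit [IsTopologicalGroup G] [IsProfiniteGroup PG] in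
theorem profRetraction_apply (hNH : IsTopologicalSemidirectProduct N H) {αG : G →ₜ* PG}
    (hG : IsProfiniteCompletion αG) (αH : H →ₜ* PH) (g : G) :
    profRetraction hNH hG αH (αG g) = αH (hNH.retraction g) :=
  hG.lift_apply _ g

omit [IsTopologicalGroup G] in
theorem profRetraction_closureImage (hNH : IsTopologicalSemidirectProduct N H) {αG : G →ₜ* PG}
    (hG : IsProfiniteCompletion αG) (αH : H →ₜ* PH) {z : PG} (hz : z ∈ closureImage αG N) :
    profRetraction hNH hG αH z = 1 := by
  refine closure_minimal (t := {z | profRetraction hNH hG αH z = 1}) ?_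
    (isClosed_eq (map_continuous _) continuous_const) hz
  rintro _ ⟨x, hx, rfl⟩
  change profRetraction hNH hG αH (αG x) = 1
  rw [profRetraction_apply, hNH.retraction_left ⟨x, hx⟩, map_one]

/-- G → H is the identity on H, so the composite is the identity on a dense subset. This is why,
unlike ψ_N, the map ψ_H has no kernel. -/
theorem profRetraction_psi (hNH : IsTopologicalSemidirectProduct N H) {αG : G →ₜ* PG}
    (hG : IsProfiniteCompletion αG) {αH : H →ₜ* PH} (hH : IsProfiniteCompletion αH) (y : PH) :
    profRetraction hNH hG αH (psi hH αG y) = y := by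
  refine congrFun (hH.denseRange.equalizer (g := fun y => profRetraction hNH hG αH (psi hH αG y))
    (h := id) ((map_continuous _).comp (continuous_subtype_val.comp (map_continuous _)))
    continuous_id (funext fun h => ?_)) y
  simp only [Function.comp_apply, id]
  rw [psi_apply, profRetraction_apply, hNH.retraction_right]

end Retraction

/-! ### The quotient Prof(N)/D -/

section Quotient

variable {G : Type u} [Group G] [TopologicalSpace G] [IsTopologicalGroup G]
  {N H : Subgroup G} [N.Normal] {PG PN : Type u} [Group PG] [TopologicalSpace PG]
  [IsProfiniteGroup PG] [Group PN] [TopologicalSpace PN]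

theorem ker_psi_eq_periodicKernel (hNH : IsTopologicalSemidirectProduct N H)
    {αG : G →ₜ* PG} (hG : IsProfiniteCompletion αG) {αN : N →ₜ* PN}
    (hN : IsProfiniteCompletion αN) :
    (psi hN αG).toMonoidHom.ker = periodicKernel H hN :=
  le_antisymm (ker_psi_le_periodicKernel hNH hG hN) (periodicKernel_le_ker_psi H αG hN)

theorem mem_periodicKernel_iff (hNH : IsTopologicalSemidirectProduct N H)
    {αG : G →ₜ* PG} (hG : IsProfiniteCompletion αG) {αN : N →ₜ* PN}
    (hN : IsProfiniteCompletion αN) {p : PN} :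
    p ∈ periodicKernel H hN ↔ psi hN αG p = 1 := by
  rw [← ker_psi_eq_periodicKernel hNH hG hN]
  rfl

theorem exists_quotient_periodicKernel_equiv (hNH : IsTopologicalSemidirectProduct N H)
    {αG : G →ₜ* PG} (hG : IsProfiniteCompletion αG) {αN : N →ₜ* PN}
    (hN : IsProfiniteCompletion αN) :
    ∃ e : (PN ⧸ periodicKernel H hN) ≃ₜ* closureImage αG N,
      ∀ x : PN, e (x : PN ⧸ periodicKernel H hN) = psi hN αG x := by
  have : IsProfiniteGroup PN := hN.profinite
  let f : (PN ⧸ periodicKernel H hN) →* closureImage αG N :=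
    QuotientGroup.lift _ (psi hN αG).toMonoidHom (ker_psi_eq_periodicKernel hNH hG hN).ge
  have hf : Continuous f := (map_continuous (psi hN αG)).quotient_lift _
  have hinj : Function.Injective f := by
    rw [injective_iff_map_eq_one]
    intro q hq
    induction q using QuotientGroup.induction_on with
    | H x => exact (QuotientGroup.eq_one_iff x).mpr ((mem_periodicKernel_iff hNH hG hN).mpr hq)
  have hsurj : Function.Surjective f := fun z => by
    obtain ⟨x, hx⟩ := psi_surjective hN αG z
    exact ⟨x, hx⟩
  obtain ⟨e, he⟩ := f.exists_continuousMulEquiv hf ⟨hinj, hsurj⟩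
  exact ⟨e, fun x => he x⟩

theorem map_profAction_periodicKernel [IsProfiniteGroup PN]
    (hNH : IsTopologicalSemidirectProduct N H)
    {αG : G →ₜ* PG} (hG : IsProfiniteCompletion αG) {αN : N →ₜ* PN}
    (hN : IsProfiniteCompletion αN) (h : H) :
    (periodicKernel H hN).map (profAction H hN h).toMonoidHom = periodicKernel H hN := by
  have key (h : H) (x : PN) (hx : x ∈ periodicKernel H hN) :
      profAction H hN h x ∈ periodicKernel H hN := by
    rw [mem_periodicKernel_iff hNH hG hN] at hx ⊢
    refine Subtype.ext ((psi_profConj hN αG (h : G) x).trans ?_)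
    simp [hx]
  -- Stability under the inverse of `h` upgrades the inclusion to an equality.
  refine le_antisymm ?_ fun y hy => ⟨profAction H hN h⁻¹ y, key _ y hy, ?_⟩
  · rintro _ ⟨x, hx, rfl⟩
    exact key h x hx
  · change (profAction H hN h * profAction H hN h⁻¹) y = y
    rw [← map_mul, mul_inv_cancel, map_one]
    rfl

end Quotient

/-! ### The semidirect decomposition of Prof(G) -/

theorem mainTheorem2 {G : Type u} [Group G] [TopologicalSpace G] [IsTopologicalGroup G]
    [LocallyCompactSpace G] [T2Space G]
    (N H : Subgroup G) [N.Normal] (hNH : IsTopologicalSemidirectProduct N H)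
    {PG PN PH : Type u}
    [Group PG] [TopologicalSpace PG] [IsProfiniteGroup PG]
    [Group PN] [TopologicalSpace PN] [IsProfiniteGroup PN]
    [Group PH] [TopologicalSpace PH] [IsProfiniteGroup PH]
    (αG : G →ₜ* PG) (hG : IsProfiniteCompletion αG)
    (αN : N →ₜ* PN) (hN : IsProfiniteCompletion αN)
    (αH : H →ₜ* PH) (hH : IsProfiniteCompletion αH) :
    -- (i)
    ((psi hN αG).toMonoidHom.ker = periodicKernel H hN ∧
      ∃ e : (PN ⧸ periodicKernel H hN) ≃ₜ* closureImage αG N,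
        ∀ x : PN, e (x : PN ⧸ periodicKernel H hN) = psi hN αG x) ∧
    -- (ii)
    (∃ e : PH ≃ₜ* closureImage αG H, ∀ y : PH, e y = psi hH αG y) ∧
    -- (iii)
    ((∀ h : H, (periodicKernel H hN).map (profAction H hN h).toMonoidHom = periodicKernel H hN) ∧
      ∃ θ : PH →* MulAut (PN ⧸ periodicKernel H hN),
        Continuous (fun p : PH × (PN ⧸ periodicKernel H hN) => θ p.1 p.2) ∧
        (∀ (h : H) (x : PN), θ (αH h) (x : PN ⧸ periodicKernel H hN) =
          (profAction H hN h x : PN ⧸ periodicKernel H hN)) ∧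
        ∃ e : ((PN ⧸ periodicKernel H hN) ⋊[θ] PH) ≃ₜ* PG,
          ∀ (x : PN) (y : PH), e ⟨(x : PN ⧸ periodicKernel H hN), y⟩ =
            (psi hN αG x : PG) * (psi hH αG y : PG)) := by
  obtain ⟨e, he⟩ := exists_quotient_periodicKernel_equiv hNH hG hN
  have hM : (closureImage αG N).Normal := closureImage_normal hG.denseRange N
  have hretr := profRetraction_psi hNH hG hH
  have hψH : Function.Injective (psi hH αG) := fun y y' hy => by
    rw [← hretr y, hy, hretr]
  refine ⟨⟨ker_psi_eq_periodicKernel hNH hG hN, e, he⟩,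
    (psi hH αG).toMonoidHom.exists_continuousMulEquiv (map_continuous (psi hH αG))
      ⟨hψH, psi_surjective hH αG⟩, map_profAction_periodicKernel hNH hG hN, ?_⟩
  let iH : PH →* PG := (closureImage αG H).subtype.comp (psi hH αG).toMonoidHom
  have hiH : Continuous iH := continuous_subtype_val.comp (map_continuous (psi hH αG))
  let iN : (PN ⧸ periodicKernel H hN) →* PG :=
    (closureImage αG N).subtype.comp e.toMulEquiv.toMonoidHom
  have hiN : Continuous iN := continuous_subtype_val.comp e.continuous
  have hiNinj : Function.Injective iN := Subtype.val_injective.comp e.injective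
  -- Conjugation by ψ_H(y) on the normal closure of α_G(N), transported along `e`. Defined this way,
  -- joint continuity comes from Prof(G) and no extension of θ from H has to be constructed.
  let θ : PH →* MulAut (PN ⧸ periodicKernel H hN) :=
    (MulAut.congr e.toMulEquiv.symm).toMonoidHom.comp
      ((MulAut.conjNormal (H := closureImage αG N)).comp iH)
  have hθ (y : PH) (q : PN ⧸ periodicKernel H hN) : iN (θ y q) = iH y * iN q * (iH y)⁻¹ :=
    congrArg Subtype.val (e.apply_symm_apply (MulAut.conjNormal (iH y) (e q)))
  refine ⟨θ, ?_, fun h x => hiNinj ?_, ?_⟩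
  · have h1 : Continuous fun p : PH × (PN ⧸ periodicKernel H hN) =>
        iH p.1 * iN p.2 * (iH p.1)⁻¹ := by fun_prop
    exact e.symm.continuous.comp
      (h1.subtype_mk fun p => hM.conj_mem _ (e p.2).2 (iH p.1))
  · rw [hθ]
    change (psi hH αG (αH h) : PG) * (e (x : PN ⧸ periodicKernel H hN) : PG) *
      (psi hH αG (αH h) : PG)⁻¹ = (e (profAction H hN h x : PN) : PG)
    rw [he, he, psi_apply]
    exact (psi_profConj hN αG (h : G) x).symm
  · let F : ((PN ⧸ periodicKernel H hN) ⋊[θ] PH) →* PG :=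
      SemidirectProduct.lift iN iH fun y => MonoidHom.ext fun q => hθ y q
    have hFdef (a) : F a = iN a.left * iH a.right := rfl
    have hF : Continuous F := by
      have h1 := SemidirectProduct.continuous_left_right θ
      exact (hiN.comp (continuous_fst.comp h1)).mul (hiH.comp (continuous_snd.comp h1))
    have hinj : Function.Injective F := by
      rw [injective_iff_map_eq_one]
      rintro ⟨q, y⟩ hq
      replace hq : iN q * iH y = 1 := hq
      -- The retraction kills the N-factor and recovers `y`, so the two factors meet trivially.
      have h1 := congrArg (profRetraction hNH hG αH) hq
      rw [map_mul, map_one, show profRetraction hNH hG αH (iN q) = 1 from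
        profRetraction_closureImage hNH hG αH (e q).2, one_mul] at h1
      obtain rfl : y = 1 := (hretr y).symm.trans h1
      rw [map_one, mul_one] at hq
      rw [(map_eq_one_iff iN hiNinj).mp hq]
      rfl
    have hsurj : Function.Surjective F := by
      -- The range is compact, hence closed, and it contains α_G(xy) for all x in N and y in H, that
      -- is, the dense image of G.
      rw [← Set.range_eq_univ, ← (isCompact_range hF).isClosed.closure_eq]
      refine (hG.denseRange.mono ?_).closure_eq
      rintro _ ⟨g, rfl⟩
      obtain ⟨x, y, rfl⟩ := hNH.exists_eq_mul g
      refine ⟨⟨(αN x : PN), αH y⟩, ?_⟩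
      rw [hFdef, map_mul]
      change (e (αN x : PN) : PG) * (psi hH αG (αH y) : PG) = _
      rw [he, psi_apply, psi_apply]
    obtain ⟨E, hE⟩ := F.exists_continuousMulEquiv hF ⟨hinj, hsurj⟩
    refine ⟨E, fun x y => (hE _).trans ?_⟩
    change (e (x : PN ⧸ periodicKernel H hN) : PG) * (psi hH αG y : PG) = _
    rw [he]
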